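/- Let $n,t\in\mathbb N$ and let $G$ be a ring (associative, not necessarily commutative, not necessarily with a unit). A polynomial in $n$ variables over $G$ is a finite sum of terms $\pm w$, where $w$ is a nonempty finite product, in any order, of constants from $G$ and variables $x_1,\dots,x_n$ (the variables commute neither with each other nor with the constants). A map $P=(p_1,\dots,p_t)\colon G^n\to G^t$ is a polynomial mapping over $G$ if each $p_l\colon G^n\to G$ is given by a polynomial in $n$ variables over $G$. **Proposition 7.9.** Let $P\colon G^n\to G^t$ be a polynomial mapping over $G$ with $P(0)=0$, let $(g_j)_{j\in\mathbb N}$ be a sequence of elements of $G^n$, and let $F\subset G^n$ be a finite set. For every $r\in\mathbb N$ and every coloring $\chi\colon G^t\to\{1,\dots,r\}$ there are $h\in G^t$ and a nonempty finite set $\gamma\subset\mathbb N$ such that, with $(x_1,\dots,x_n)=\sum_{j\in\gamma}g_j\in G^n$, the set $$\{\,h+P(x_1v_1,\dots,x_nv_n) : (v_1,\dots,v_n)\in F\,\}$$ is monochromatic, i.e. $\chi$ is constant on it. -/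

import Mathlib

/-- `p : G^n → G` is the map of a polynomial in `n` variables over the (not necessarily commutative,
not necessarily unital) ring `G`: it is a finite sum of signed nonempty finite products, the factors of which
are constants from `G` and coordinate functions `x ↦ x i`, in any order. In other words, it lies in
the ring of functions generated by the constants and the coordinate functions. -/
def IsPolynomialFun {G : Type*} [NonUnitalRing G] {n : ℕ} (p : (Fin n → G) → G) : Prop :=
  p ∈ NonUnitalSubring.closure
    (Set.range (fun (c : G) (_ : Fin n → G) => c) ∪
      Set.range (fun (i : Fin n) (x : Fin n → G) => x i))

/-- `P : G^n → G^t` is a polynomial mapping over `G`: each of its `t` components is a polynomial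
in `n` variables over `G`. -/
def IsPolynomialMapping {G : Type*} [NonUnitalRing G] {n t : ℕ}
    (P : (Fin n → G) → (Fin t → G)) : Prop :=
  ∀ l : Fin t, IsPolynomialFun (fun x => P x l)

/-- The set `M` is monochromatic for the coloring `χ`: `χ` is constant on `M`. -/
def IsMonochromatic {W : Type*} {r : ℕ} (χ : W → Fin r) (M : Set W) : Prop :=
  ∃ c : Fin r, ∀ w ∈ M, χ w = c

/-!
Polynomials over `G` are polynomial maps of commutative groups: sufficiently many difference
operators kill them. For such maps one runs polynomial van der Waerden by PET induction. For a
finite family `A` of maps vanishing at `0` and a member `p₁` of least degree, the maps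
`x ↦ p (x + a) - p a - p₁ x` have smaller weight: the leading terms of higher degree do not change,
and in the degree of `p₁` all leading terms are shifted by that of `p₁`, so one of them disappears.
By color focusing, regularity of these smaller families yields regularity of `A`: applied to the
coloring that records the pattern of `χ` on a finite window, it moves the focus of `s` spokes of
distinct colors to a new point at which there is one further color.
-/

section PolynomialMaps

open fwdDiff fwdDiff_aux

/-- The maps between commutative groups killed by any `k` successive difference operators, i.e. the
polynomial maps of degree less than `k` in the sense of Leibman. -/
def polyMapDegreeLT (Z H : Type*) [AddCommGroup Z] [AddCommGroup H] : ℕ → Submodule ℤ (Z → H)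
  | 0 => ⊥
  | k + 1 => ⨅ a, (polyMapDegreeLT Z H k).comap (fwdDiffₗ Z H a)

variable {Y Z H : Type*} [AddCommGroup Y] [AddCommGroup Z] [AddCommGroup H]

/-- Polynomial maps between commutative groups in the sense of Leibman: maps of some finite degree,
where the degree is measured by iterated differences. -/
def IsPolyMap (p : Z → H) : Prop :=
  ∃ k, p ∈ polyMapDegreeLT Z H k

theorem mem_polyMapDegreeLT_zero {p : Z → H} : p ∈ polyMapDegreeLT Z H 0 ↔ p = 0 :=
  Submodule.mem_bot ℤ

theorem mem_polyMapDegreeLT_succ {k : ℕ} {p : Z → H} :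
    p ∈ polyMapDegreeLT Z H (k + 1) ↔ ∀ a, Δ_[a] p ∈ polyMapDegreeLT Z H k :=
  Submodule.mem_iInf _

theorem polyMapDegreeLT_mono : Monotone (polyMapDegreeLT Z H) := by
  refine monotone_nat_of_le_succ fun k => ?_
  induction k with
  | zero => exact bot_le
  | succ k ih =>
    intro p hp
    rw [mem_polyMapDegreeLT_succ] at hp ⊢
    exact fun a => ih (hp a)

theorem const_mem_polyMapDegreeLT {k : ℕ} (hk : k ≠ 0) (c : H) :
    (fun _ : Z => c) ∈ polyMapDegreeLT Z H k := by
  obtain ⟨k, rfl⟩ := Nat.exists_eq_succ_of_ne_zero hk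
  refine mem_polyMapDegreeLT_succ.2 fun a => ?_
  rw [fwdDiff_const]
  exact zero_mem _

theorem eq_zero_of_mem_polyMapDegreeLT_one {p : Z → H} (hp : p ∈ polyMapDegreeLT Z H 1)
    (hp0 : p 0 = 0) : p = 0 := by
  funext a
  have hΔ := congrFun (mem_polyMapDegreeLT_zero.1 (mem_polyMapDegreeLT_succ.1 hp a)) 0
  simpa [fwdDiff, hp0] using hΔ

theorem comp_affine_mem_polyMapDegreeLT (φ : Y →+ Z) (b : Z) {k : ℕ} {p : Z → H}
    (hp : p ∈ polyMapDegreeLT Z H k) : (fun y => p (φ y + b)) ∈ polyMapDegreeLT Y H k := by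
  induction k generalizing p with
  | zero =>
    rw [mem_polyMapDegreeLT_zero] at hp ⊢
    subst hp
    rfl
  | succ k ih =>
    rw [mem_polyMapDegreeLT_succ] at hp ⊢
    intro a
    convert ih (hp (φ a)) using 1
    funext y
    simp only [fwdDiff, map_add, add_right_comm]

theorem translate_mem_polyMapDegreeLT_iff {k : ℕ} {p : Z → H} (a : Z) :
    (fun x => p (x + a)) ∈ polyMapDegreeLT Z H k ↔ p ∈ polyMapDegreeLT Z H k := by
  refine ⟨fun hp => ?_, comp_affine_mem_polyMapDegreeLT (AddMonoidHom.id Z) a⟩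
  simpa using comp_affine_mem_polyMapDegreeLT (AddMonoidHom.id Z) (-a) hp

theorem addMonoidHom_mem_polyMapDegreeLT (φ : Z →+ H) : ⇑φ ∈ polyMapDegreeLT Z H 2 := by
  refine mem_polyMapDegreeLT_succ.2 fun a => ?_
  convert const_mem_polyMapDegreeLT one_ne_zero (φ a) using 1
  funext x
  simp [fwdDiff]

theorem mem_polyMapDegreeLT_pi {ι : Type*} {k : ℕ} {p : Z → ι → H}
    (hp : ∀ i, (fun x => p x i) ∈ polyMapDegreeLT Z H k) :
    p ∈ polyMapDegreeLT Z (ι → H) k := by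
  induction k generalizing p with
  | zero =>
    simp only [mem_polyMapDegreeLT_zero] at hp ⊢
    funext x i
    exact congrFun (hp i) x
  | succ k ih =>
    simp only [mem_polyMapDegreeLT_succ] at hp ⊢
    exact fun a => ih fun i => hp i a

theorem fwdDiff_mul {M R : Type*} [AddCommMonoid M] [NonUnitalNonAssocRing R] (a : M)
    (p q : M → R) :
    Δ_[a] (p * q) = Δ_[a] p * q + p * Δ_[a] q + Δ_[a] p * Δ_[a] q := by
  funext x
  simp only [fwdDiff, Pi.mul_apply, Pi.add_apply, mul_sub, sub_mul]
  abel

theorem mul_mem_polyMapDegreeLT {R : Type*} [NonUnitalNonAssocRing R] {k l : ℕ} {p q : Z → R}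
    (hp : p ∈ polyMapDegreeLT Z R k) (hq : q ∈ polyMapDegreeLT Z R l) :
    p * q ∈ polyMapDegreeLT Z R (k + l) := by
  induction k generalizing l p q with
  | zero => simp [mem_polyMapDegreeLT_zero.1 hp]
  | succ k ihk =>
    induction l generalizing p q with
    | zero => simp [mem_polyMapDegreeLT_zero.1 hq]
    | succ l ihl =>
      rw [← add_assoc, mem_polyMapDegreeLT_succ]
      intro a
      have hΔp := mem_polyMapDegreeLT_succ.1 hp a
      have hΔq := mem_polyMapDegreeLT_succ.1 hq a
      rw [fwdDiff_mul]
      refine add_mem (add_mem ?_ (ihl hp hΔq)) ?_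
      · exact polyMapDegreeLT_mono (by omega) (ihk hΔp hq)
      · exact polyMapDegreeLT_mono (by omega) (ihk hΔp hΔq)

theorem IsPolyMap.comp_addMonoidHom {p : Z → H} (hp : IsPolyMap p) (φ : Y →+ Z) :
    IsPolyMap fun y => p (φ y) := by
  obtain ⟨k, hk⟩ := hp
  exact ⟨k, by simpa using comp_affine_mem_polyMapDegreeLT φ 0 hk⟩

theorem exists_forall_mem_polyMapDegreeLT {ι : Type*} (s : Finset ι) {p : ι → Z → H}
    (hp : ∀ i ∈ s, IsPolyMap (p i)) : ∃ D, ∀ i ∈ s, p i ∈ polyMapDegreeLT Z H D := by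
  choose! k hk using hp
  exact ⟨s.sup k, fun i hi => polyMapDegreeLT_mono (Finset.le_sup hi) (hk i hi)⟩

theorem IsPolyMap.pi {ι : Type*} [Finite ι] {p : Z → ι → H}
    (hp : ∀ i, IsPolyMap fun x => p x i) : IsPolyMap p := by
  have := Fintype.ofFinite ι
  obtain ⟨D, hD⟩ := exists_forall_mem_polyMapDegreeLT Finset.univ fun i _ => hp i
  exact ⟨D, mem_polyMapDegreeLT_pi fun i => hD i (Finset.mem_univ i)⟩

theorem IsPolynomialFun.isPolyMap {G : Type*} [NonUnitalRing G] {n : ℕ}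
    {p : (Fin n → G) → G} (hp : IsPolynomialFun p) : IsPolyMap p := by
  induction hp using NonUnitalSubring.closure_induction with
  | mem p hp =>
    rcases hp with ⟨c, rfl⟩ | ⟨i, rfl⟩
    · exact ⟨1, const_mem_polyMapDegreeLT one_ne_zero c⟩
    · exact ⟨2, addMonoidHom_mem_polyMapDegreeLT (Pi.evalAddMonoidHom (fun _ => G) i)⟩
  | zero => exact ⟨0, zero_mem _⟩
  | add p q _ _ hp hq =>
    obtain ⟨k, hk⟩ := hp
    obtain ⟨l, hl⟩ := hq
    exact ⟨max k l, add_mem (polyMapDegreeLT_mono (le_max_left k l) hk)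
      (polyMapDegreeLT_mono (le_max_right k l) hl)⟩
  | neg p _ hp =>
    obtain ⟨k, hk⟩ := hp
    exact ⟨k, neg_mem hk⟩
  | mul p q _ _ hp hq =>
    obtain ⟨k, hk⟩ := hp
    obtain ⟨l, hl⟩ := hq
    exact ⟨k + l, mul_mem_polyMapDegreeLT hk hl⟩

theorem IsPolynomialMapping.isPolyMap {G : Type*} [NonUnitalRing G] {n t : ℕ}
    {P : (Fin n → G) → (Fin t → G)} (hP : IsPolynomialMapping P) : IsPolyMap P :=
  .pi fun l => (hP l).isPolyMap

end PolynomialMaps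

section ColorFocusing

open scoped Pointwise

variable {ι Z H κ : Type*} [AddCommGroup Z] [AddCommGroup H]

/-- The sums of `g` over the subsets of `I`, including the empty one. -/
def subsetSums (g : ι → Z) (I : Finset ι) : Set Z :=
  (fun γ => ∑ j ∈ γ, g j) '' {γ | γ ⊆ I}

theorem finite_subsetSums (g : ι → Z) (I : Finset ι) : (subsetSums g I).Finite := by
  classical
  exact (Set.finite_Iic I).image _

theorem zero_mem_subsetSums (g : ι → Z) (I : Finset ι) : 0 ∈ subsetSums g I :=
  ⟨∅, I.empty_subset, Finset.sum_empty⟩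

/-- The colors of the monochromatic configurations `{h + p (∑ j ∈ γ, g j) | p ∈ A}` (the *spokes*)
with focus `h` and nonempty `γ ⊆ I`. -/
def spokeColors (g : ι → Z) (A : Set (Z → H)) (χ : H → κ) (I : Finset ι) (h : H) : Set κ :=
  {c | ∃ γ ⊆ I, γ.Nonempty ∧ ∀ p ∈ A, χ (h + p (∑ j ∈ γ, g j)) = c}

/-- The family `A` is *IP partition regular* along `g`: every finite coloring of `H` has a
point `h` with a spoke of its own color. The definition is finitary, in that the indices and the
point `h` are found in finite sets chosen before the coloring; the indices avoid any prescribed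
finite set `J`. -/
def IsIPPartitionRegular (g : ι → Z) (A : Set (Z → H)) : Prop :=
  ∀ (κ : Type) [Finite κ] (J : Finset ι), ∃ I : Finset ι, Disjoint J I ∧
    ∃ Q : Set H, Q.Finite ∧ ∀ χ : H → κ, ∃ h ∈ Q, χ h ∈ spokeColors g A χ I h

/-- The van der Corput step `p ↦ p (· + a) - p a - p₁`, normalized to preserve maps that
vanish at `0`. -/
def vdcMap (p₁ p : Z → H) (a : Z) : Z → H :=
  fun x => p (x + a) - p a - p₁ x

/-- The van der Corput maps of the members of `A`, for all translations in `S`. -/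
def vdcFamily (A : Set (Z → H)) (p₁ : Z → H) (S : Set Z) : Set (Z → H) :=
  Set.image2 (vdcMap p₁) A S

variable {g : ι → Z} {A : Set (Z → H)}

theorem spokeColors_mono {χ : H → κ} {I I' : Finset ι} (hI : I ⊆ I') (h : H) :
    spokeColors g A χ I h ⊆ spokeColors g A χ I' h :=
  fun _ ⟨γ, hγ, hc⟩ => ⟨γ, hγ.trans hI, hc⟩

theorem spokeColors_translate (χ : H → κ) (I : Finset ι) (y h : H) :
    spokeColors g A (fun z => χ (y + z)) I h = spokeColors g A χ I (y + h) := by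
  simp only [spokeColors, add_assoc]

theorem isIPPartitionRegular_empty [Infinite ι] (g : ι → Z) :
    IsIPPartitionRegular g (∅ : Set (Z → H)) := by
  intro κ _ J
  obtain ⟨j, hj⟩ := Infinite.exists_notMem_finset J
  exact ⟨{j}, Finset.disjoint_singleton_right.2 hj, {0}, Set.finite_singleton 0,
    fun χ => ⟨0, rfl, {j}, by simp⟩⟩

theorem IsIPPartitionRegular.of_diff_zero (hA : IsIPPartitionRegular g (A \ {0})) :
    IsIPPartitionRegular g A := by
  intro κ _ J
  obtain ⟨I, hJI, Q, hQ, hχ⟩ := hA κ J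
  refine ⟨I, hJI, Q, hQ, fun χ => ?_⟩
  obtain ⟨h, hh, γ, hγ, hγne, hc⟩ := hχ χ
  refine ⟨h, hh, γ, hγ, hγne, fun p hp => ?_⟩
  by_cases hp0 : p = 0
  · simp [hp0]
  · exact hc p ⟨hp, hp0⟩

/-- This is regularity for the coloring that records the pattern of `χ` on the translates of `T`. -/
theorem IsIPPartitionRegular.exists_translate (hA : IsIPPartitionRegular g A) {T : Set H}
    (hT : T.Finite) (κ : Type) [Finite κ] (J : Finset ι) :
    ∃ I : Finset ι, Disjoint J I ∧ ∃ Q : Set H, Q.Finite ∧ ∀ χ : H → κ, ∃ y ∈ Q,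
      ∃ γ ⊆ I, γ.Nonempty ∧ ∀ p ∈ A, ∀ t ∈ T, χ (y + p (∑ j ∈ γ, g j) + t) = χ (y + t) := by
  obtain ⟨m, t, -, rfl⟩ := hT.fin_param
  obtain ⟨I, hJI, Q, hQ, hχ⟩ := hA (Fin m → κ) J
  refine ⟨I, hJI, Q, hQ, fun χ => ?_⟩
  obtain ⟨y, hy, γ, hγ, hγne, hc⟩ := hχ fun y i => χ (y + t i)
  exact ⟨y, hy, γ, hγ, hγne, fun p hp => Set.forall_mem_range.2 (congrFun (hc p hp))⟩

/-- The spoke of `h` over `β` becomes one over `γ ∪ β`, and the old focus `h` becomes the spoke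
over `γ`. -/
theorem insert_spokeColors_subset [DecidableEq ι] (hA0 : ∀ p ∈ A, p 0 = 0) {p₁ : Z → H}
    {χ : H → κ} {h : H} {I I' γ : Finset ι} (hII' : Disjoint I I') (hγ : γ ⊆ I')
    (hγne : γ.Nonempty)
    (hχ : ∀ p ∈ A, ∀ a ∈ subsetSums g I,
      χ (h - p₁ (∑ j ∈ γ, g j) + p (∑ j ∈ γ, g j + a)) = χ (h + p a)) :
    insert (χ h) (spokeColors g A χ I h) ⊆
      spokeColors g A χ (I ∪ I') (h - p₁ (∑ j ∈ γ, g j)) := by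
  have hγI : γ ⊆ I ∪ I' := hγ.trans Finset.subset_union_right
  rintro _ (rfl | ⟨β, hβ, -, hc⟩)
  · refine ⟨γ, hγI, hγne, fun p hp => ?_⟩
    simpa [hA0 p hp] using hχ p hp 0 (zero_mem_subsetSums g I)
  · refine ⟨γ ∪ β, Finset.union_subset hγI (hβ.trans Finset.subset_union_left),
      hγne.mono Finset.subset_union_left, fun p hp => ?_⟩
    rw [Finset.sum_union (hII'.symm.mono hγ hβ), hχ p hp _ ⟨β, hβ, rfl⟩, hc p hp]

theorem exists_mem_spokeColors_or_le_ncard (hA : A.Finite) (hA0 : ∀ p ∈ A, p 0 = 0) (p₁ : Z → H)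
    (hvdc : ∀ S : Set Z, S.Finite → 0 ∈ S → IsIPPartitionRegular g (vdcFamily A p₁ S))
    (κ : Type) [Finite κ] (J : Finset ι) (s : ℕ) :
    ∃ I : Finset ι, Disjoint J I ∧ ∃ Q : Set H, Q.Finite ∧ ∀ χ : H → κ, ∃ h ∈ Q,
      χ h ∈ spokeColors g A χ I h ∨ s ≤ (spokeColors g A χ I h).ncard := by
  classical
  induction s with
  | zero => exact ⟨∅, disjoint_bot_right, {0}, Set.finite_singleton 0,
      fun _ => ⟨0, rfl, Or.inr (Nat.zero_le _)⟩⟩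
  | succ s ih =>
    obtain ⟨I, hJI, Q, hQ, hfocus⟩ := ih
    have hS := finite_subsetSums g I
    have hT : (Q + Set.image2 (fun p a => p a) A (subsetSums g I)).Finite :=
      hQ.add (hA.image2 _ hS)
    obtain ⟨I', hJI', Q', hQ', hreg⟩ :=
      (hvdc _ hS (zero_mem_subsetSums g I)).exists_translate hT κ (J ∪ I)
    obtain ⟨hJI', hII'⟩ := Finset.disjoint_union_left.1 hJI'
    refine ⟨I ∪ I', Finset.disjoint_union_right.2 ⟨hJI, hJI'⟩,
      (Q' + Q) ∪ ((Q' + Q) - p₁ '' subsetSums g I'),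
      (hQ'.add hQ).union ((hQ'.add hQ).sub ((finite_subsetSums g I').image _)), fun χ => ?_⟩
    obtain ⟨y, hy, γ, hγ, hγne, hyγ⟩ := hreg χ
    obtain ⟨h, hh, hh'⟩ := hfocus fun z => χ (y + z)
    have hyh : y + h ∈ Q' + Q := Set.add_mem_add hy hh
    rw [spokeColors_translate] at hh'
    by_cases hspoke : χ (y + h) ∈ spokeColors g A χ I (y + h)
    · exact ⟨y + h, Or.inl hyh, Or.inl (spokeColors_mono Finset.subset_union_left _ hspoke)⟩
    have hcard := hh'.resolve_left hspoke
    refine ⟨y + h - p₁ (∑ j ∈ γ, g j), Or.inr (Set.sub_mem_sub hyh ⟨_, ⟨γ, hγ, rfl⟩, rfl⟩),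
      Or.inr ?_⟩
    have hχ : ∀ p ∈ A, ∀ a ∈ subsetSums g I,
        χ (y + h - p₁ (∑ j ∈ γ, g j) + p (∑ j ∈ γ, g j + a)) = χ (y + h + p a) := by
      intro p hp a ha
      convert hyγ _ ⟨p, hp, a, ha, rfl⟩ (h + p a) (Set.add_mem_add hh ⟨p, hp, a, ha, rfl⟩) using 2
      · simp only [vdcMap]
        abel
      · exact add_assoc y h (p a)
    calc s + 1 ≤ (spokeColors g A χ I (y + h)).ncard + 1 := Nat.succ_le_succ hcard
      _ = (insert (χ (y + h)) (spokeColors g A χ I (y + h))).ncard :=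
        (Set.ncard_insert_of_notMem hspoke).symm
      _ ≤ _ := Set.ncard_le_ncard (insert_spokeColors_subset hA0 hII' hγ hγne hχ)

theorem IsIPPartitionRegular.of_vdcFamily (hA : A.Finite) (hA0 : ∀ p ∈ A, p 0 = 0) (p₁ : Z → H)
    (hvdc : ∀ S : Set Z, S.Finite → 0 ∈ S → IsIPPartitionRegular g (vdcFamily A p₁ S)) :
    IsIPPartitionRegular g A := by
  intro κ _ J
  obtain ⟨I, hJI, Q, hQ, hfocus⟩ :=
    exists_mem_spokeColors_or_le_ncard hA hA0 p₁ hvdc κ J (Nat.card κ)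
  refine ⟨I, hJI, Q, hQ, fun χ => ?_⟩
  obtain ⟨h, hh, hspoke | hcard⟩ := hfocus χ
  · exact ⟨h, hh, hspoke⟩
  · have hall : spokeColors g A χ I h = Set.univ :=
      (Set.eq_univ_iff_ncard _).2 (le_antisymm (Set.ncard_le_card _) hcard)
    exact ⟨h, hh, hall ▸ Set.mem_univ (χ h)⟩

end ColorFocusing

section WeightInduction

variable {ι Z H : Type*} [AddCommGroup Z] [AddCommGroup H]

/-- The leading terms of the members of `A` of degree exactly `k`, i.e. their classes modulo maps
of smaller degree. -/
def leadingClasses (A : Set (Z → H)) (k : ℕ) : Set ((Z → H) ⧸ polyMapDegreeLT Z H k) :=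
  Submodule.Quotient.mk '' {p ∈ A | p ∈ polyMapDegreeLT Z H (k + 1) ∧ p ∉ polyMapDegreeLT Z H k}

/-- The weight of a family of polynomial maps of degree less than `D`: its numbers of leading terms
in each degree, compared from the highest degree downwards. -/
noncomputable def polyWeight (D : ℕ) (A : Set (Z → H)) : Colex (Fin D → ℕ) :=
  toColex fun k => (leadingClasses A k).ncard

variable {A : Set (Z → H)} {p p₁ : Z → H} {S : Set Z} {a : Z} {k d D : ℕ}

theorem vdcMap_mem_polyMapDegreeLT_iff (hk : k ≠ 0) (hp₁ : p₁ ∈ polyMapDegreeLT Z H k) :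
    vdcMap p₁ p a ∈ polyMapDegreeLT Z H k ↔ p ∈ polyMapDegreeLT Z H k := by
  have hvdc : vdcMap p₁ p a = (fun x => p (x + a)) - ((fun _ => p a) + p₁) := by
    funext x
    simp only [vdcMap, Pi.sub_apply, Pi.add_apply, sub_sub]
  rw [hvdc, Submodule.sub_mem_iff_left _ (add_mem (const_mem_polyMapDegreeLT hk (p a)) hp₁),
    translate_mem_polyMapDegreeLT_iff]

theorem mk_vdcMap (hk : k ≠ 0) (hp : p ∈ polyMapDegreeLT Z H (k + 1)) :
    (Submodule.Quotient.mk (vdcMap p₁ p a) : (Z → H) ⧸ polyMapDegreeLT Z H k) =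
      Submodule.Quotient.mk p - Submodule.Quotient.mk p₁ := by
  rw [← Submodule.Quotient.mk_sub, Submodule.Quotient.eq]
  convert sub_mem (mem_polyMapDegreeLT_succ.1 hp a) (const_mem_polyMapDegreeLT hk (p a)) using 1
  funext x
  simp only [vdcMap, fwdDiff, Pi.sub_apply]
  abel

theorem finite_leadingClasses (hA : A.Finite) (k : ℕ) : (leadingClasses A k).Finite :=
  (hA.sep _).image _

theorem leadingClasses_diff_zero (A : Set (Z → H)) (k : ℕ) :
    leadingClasses (A \ {0}) k = leadingClasses A k := by
  unfold leadingClasses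
  congr 1
  ext p
  refine ⟨fun ⟨hp, hpk⟩ => ⟨hp.1, hpk⟩, fun ⟨hp, hpk⟩ => ⟨⟨hp, ?_⟩, hpk⟩⟩
  rintro rfl
  exact hpk.2 (zero_mem _)

theorem leadingClasses_vdcFamily (hk : k ≠ 0) (hp₁ : p₁ ∈ polyMapDegreeLT Z H k)
    (hS : S.Nonempty) : leadingClasses (vdcFamily A p₁ S) k = leadingClasses A k := by
  have hp₁' := polyMapDegreeLT_mono k.le_succ hp₁
  have hmk {p : Z → H} (a : Z) (hp : p ∈ polyMapDegreeLT Z H (k + 1)) :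
      (Submodule.Quotient.mk (vdcMap p₁ p a) : (Z → H) ⧸ polyMapDegreeLT Z H k) =
        Submodule.Quotient.mk p := by
    rw [mk_vdcMap hk hp, (Submodule.Quotient.mk_eq_zero _).2 hp₁, sub_zero]
  refine Set.Subset.antisymm ?_ ?_
  · rintro _ ⟨_, ⟨⟨p, hp, a, -, rfl⟩, hpk⟩, rfl⟩
    rw [vdcMap_mem_polyMapDegreeLT_iff k.succ_ne_zero hp₁',
      vdcMap_mem_polyMapDegreeLT_iff hk hp₁] at hpk
    exact ⟨p, ⟨hp, hpk⟩, (hmk a hpk.1).symm⟩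
  · rintro _ ⟨p, ⟨hp, hpk⟩, rfl⟩
    obtain ⟨a, ha⟩ := hS
    refine ⟨vdcMap p₁ p a, ⟨⟨p, hp, a, ha, rfl⟩, ?_⟩, hmk a hpk.1⟩
    rwa [vdcMap_mem_polyMapDegreeLT_iff k.succ_ne_zero hp₁',
      vdcMap_mem_polyMapDegreeLT_iff hk hp₁]

theorem ncard_leadingClasses_vdcFamily_lt (hA : A.Finite) (hd : d ≠ 0)
    (hAd : ∀ p ∈ A, p ∉ polyMapDegreeLT Z H d) (hp₁A : p₁ ∈ A)
    (hp₁ : p₁ ∈ polyMapDegreeLT Z H (d + 1)) :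
    (leadingClasses (vdcFamily A p₁ S) d).ncard < (leadingClasses A d).ncard := by
  have hfin := finite_leadingClasses hA d
  let c₁ : (Z → H) ⧸ polyMapDegreeLT Z H d := Submodule.Quotient.mk p₁
  have hc₁ : c₁ ∈ leadingClasses A d := ⟨p₁, ⟨hp₁A, hp₁, hAd p₁ hp₁A⟩, rfl⟩
  have hsub : leadingClasses (vdcFamily A p₁ S) d ⊆ (· - c₁) '' (leadingClasses A d \ {c₁}) := by
    rintro _ ⟨_, ⟨⟨p, hp, a, -, rfl⟩, hpd, hpd'⟩, rfl⟩
    rw [vdcMap_mem_polyMapDegreeLT_iff d.succ_ne_zero hp₁] at hpd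
    rw [← Submodule.Quotient.mk_eq_zero, mk_vdcMap hd hpd, sub_eq_zero] at hpd'
    exact ⟨_, ⟨⟨p, ⟨hp, hpd, hAd p hp⟩, rfl⟩, hpd'⟩, (mk_vdcMap hd hpd).symm⟩
  calc _ ≤ ((· - c₁) '' (leadingClasses A d \ {c₁})).ncard :=
        Set.ncard_le_ncard hsub (hfin.sdiff.image _)
    _ ≤ (leadingClasses A d \ {c₁}).ncard := Set.ncard_image_le hfin.sdiff
    _ < _ := Set.ncard_sdiff_singleton_lt_of_mem hc₁ hfin

theorem polyWeight_vdcFamily_lt (hA : A.Finite) (hd : d ≠ 0) (hdD : d < D)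
    (hAd : ∀ p ∈ A, p ∉ polyMapDegreeLT Z H d) (hp₁A : p₁ ∈ A)
    (hp₁ : p₁ ∈ polyMapDegreeLT Z H (d + 1)) (hS : S.Nonempty) :
    polyWeight D (vdcFamily A p₁ S) < polyWeight D A := by
  refine ⟨⟨d, hdD⟩, fun k hk => ?_, ncard_leadingClasses_vdcFamily_lt hA hd hAd hp₁A hp₁⟩
  have hdk : d < k := hk
  exact congrArg Set.ncard
    (leadingClasses_vdcFamily (by omega) (polyMapDegreeLT_mono hdk hp₁) hS)

theorem exists_minimal_degree (hA : A.Nonempty) (hAD : A ⊆ polyMapDegreeLT Z H D)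
    (hA0 : ∀ p ∈ A, p 0 = 0) (hne : 0 ∉ A) :
    ∃ d, d ≠ 0 ∧ d < D ∧ (∀ p ∈ A, p ∉ polyMapDegreeLT Z H d) ∧
      ∃ p₁ ∈ A, p₁ ∈ polyMapDegreeLT Z H (d + 1) := by
  classical
  obtain ⟨q, hq⟩ := hA
  have hex : ∃ m, ∃ p ∈ A, p ∈ polyMapDegreeLT Z H m := ⟨D, q, hq, hAD hq⟩
  have hmD : Nat.find hex ≤ D := Nat.find_min' hex ⟨q, hq, hAD hq⟩
  obtain ⟨p₁, hp₁A, hp₁⟩ := Nat.find_spec hex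
  have hm : 1 < Nat.find hex := by
    by_contra! hle
    exact hne (eq_zero_of_mem_polyMapDegreeLT_one (polyMapDegreeLT_mono hle hp₁)
      (hA0 p₁ hp₁A) ▸ hp₁A)
  refine ⟨Nat.find hex - 1, by omega, by omega, fun p hp hpd => ?_, p₁, hp₁A, ?_⟩
  · exact Nat.find_min hex (by omega) ⟨p, hp, hpd⟩
  · rwa [Nat.sub_add_cancel hm.le]

theorem isIPPartitionRegular_of_subset_polyMapDegreeLT [Infinite ι] (g : ι → Z) (hA : A.Finite)
    (hAD : A ⊆ polyMapDegreeLT Z H D) (hA0 : ∀ p ∈ A, p 0 = 0) : IsIPPartitionRegular g A := by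
  induction hw : polyWeight D A using WellFoundedLT.induction generalizing A with
  | ind w ih =>
    subst hw
    refine .of_diff_zero ?_
    have hweight : polyWeight D (A \ {0}) = polyWeight D A := by
      simp only [polyWeight, leadingClasses_diff_zero]
    have hB : (A \ {0}).Finite := hA.sdiff
    have hBD : A \ {0} ⊆ polyMapDegreeLT Z H D := Set.sdiff_subset.trans hAD
    have hB0 : ∀ p ∈ A \ {0}, p 0 = 0 := fun p hp => hA0 p hp.1
    rcases (A \ {0}).eq_empty_or_nonempty with hempty | hne
    · exact hempty ▸ isIPPartitionRegular_empty g
    obtain ⟨d, hd, hdD, hBd, p₁, hp₁B, hp₁⟩ :=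
      exists_minimal_degree hne hBD hB0 fun h => h.2 rfl
    refine .of_vdcFamily hB hB0 p₁ fun S hS hS0 => ih _ ?_ (hB.image2 _ hS) ?_ ?_ rfl
    · exact hweight ▸ polyWeight_vdcFamily_lt hB hd hdD hBd hp₁B hp₁ ⟨0, hS0⟩
    · rintro _ ⟨p, hp, a, -, rfl⟩
      exact (vdcMap_mem_polyMapDegreeLT_iff (by omega) (hBD hp₁B)).2 (hBD hp)
    · rintro _ ⟨p, -, a, -, rfl⟩
      simp [vdcMap, hB0 p₁ hp₁B]

end WeightInduction

theorem proposition7p9_general {ι α Z H : Type*} [Infinite ι] [AddCommGroup Z] [AddCommGroup H]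
    (P : α → Z → H) (F : Finset α) (hP : ∀ v ∈ F, IsPolyMap (P v)) (hP0 : ∀ v ∈ F, P v 0 = 0)
    (g : ι → Z) {r : ℕ} (χ : H → Fin r) :
    ∃ (h : H) (γ : Finset ι), γ.Nonempty ∧
      IsMonochromatic χ {y | ∃ v ∈ F, y = h + P v (∑ j ∈ γ, g j)} := by
  obtain ⟨D, hD⟩ := exists_forall_mem_polyMapDegreeLT F hP
  have hreg : IsIPPartitionRegular g (P '' F) :=
    isIPPartitionRegular_of_subset_polyMapDegreeLT g (F.finite_toSet.image P)
      (Set.image_subset_iff.2 hD) (Set.forall_mem_image.2 hP0)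
  obtain ⟨_, -, _, -, hχ⟩ := hreg (Fin r) ∅
  obtain ⟨h, -, γ, -, hγ, hc⟩ := hχ χ
  refine ⟨h, γ, hγ, χ h, ?_⟩
  rintro _ ⟨v, hv, rfl⟩
  exact hc (P v) ⟨v, hv, rfl⟩

theorem proposition7p9 {G : Type*} [NonUnitalRing G] {n t : ℕ}
    (P : (Fin n → G) → (Fin t → G)) (hP : IsPolynomialMapping P) (hP0 : P 0 = 0)
    (g : ℕ → (Fin n → G)) (F : Finset (Fin n → G))
    {r : ℕ} (χ : (Fin t → G) → Fin r) :
    ∃ (h : Fin t → G) (γ : Finset ℕ), γ.Nonempty ∧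
      IsMonochromatic χ
        {y | ∃ v ∈ F, y = h + P (fun i => (∑ j ∈ γ, g j) i * v i)} := by
  exact proposition7p9_general (fun v x => P fun i => x i * v i) F
    (fun v _ => hP.isPolyMap.comp_addMonoidHom (AddMonoidHom.mulRight v))
    (fun v _ => by simpa [← Pi.zero_def] using hP0) g χ
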